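/- A contractive similitude of $\mathbb R$ is a map $f(x)=rx+a$ with $r,a\in\mathbb R$ and $0<|r|<1$. The attractor of a finite family $f_1,\dots,f_\ell$ of contractive similitudes of $\mathbb R$ is the unique non-empty compact set $K\subset\mathbb R$ with $K=\bigcup_{i=1}^{\ell}f_i(K)$. A subset of $\mathbb R$ is called self-similar if it is the attractor of some finite family of contractive similitudes of $\mathbb R$ (no separation condition is required). For $t\in\mathbb R$ write $K+t=\{x+t:x\in K\}$. (i) Let $\lambda_0,\lambda_1>0$ with $\lambda_0+\lambda_1<1$ and $\log\lambda_0/\log\lambda_1\notin\mathbb Q$, and let $K$ be the attractor of $\{x\mapsto\lambda_0x,\ x\mapsto\lambda_1x+1-\lambda_1\}$. Then for every integer $m\ge1$ and all pairwise distinct real numbers $t_0,t_1,\dots,t_m$, the union $\bigcup_{j=0}^m(K+t_j)$ is not self-similar. (ii) Let $0<\lambda<1/3$ and $\lambda<\zeta<1-2\lambda$ with $\zeta\notin\mathbb Q(\lambda)$, and let $K$ be the attractor of $\{x\mapsto\lambda x,\ x\mapsto\lambda x+\zeta,\ x\mapsto\lambda x+1-\lambda\}$. Then for every real $t>0$, the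 union $K\cup(K+t)$ is not self-similar. -/

import Mathlib

/-- A contractive similitude of the real line: `x ↦ r x + a` with `0 < |r| < 1`. -/
def IsContractiveSimilitude (f : ℝ → ℝ) : Prop :=
  ∃ r a : ℝ, 0 < |r| ∧ |r| < 1 ∧ ∀ x, f x = r * x + a

/-- `K` is the attractor of the finite family `f`: non-empty, compact, and the union of its images
under the members of the family. -/
def IsAttractor {n : ℕ} (f : Fin n → ℝ → ℝ) (K : Set ℝ) : Prop :=
  K.Nonempty ∧ IsCompact K ∧ K = ⋃ i, f i '' K

/-- A self-similar subset of the real line: the attractor of some finite family of contractive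
similitudes. No separation condition is imposed. -/
def IsSelfSimilarSet (K : Set ℝ) : Prop :=
  ∃ (n : ℕ) (f : Fin n → ℝ → ℝ), (∀ i, IsContractiveSimilitude (f i)) ∧ IsAttractor f K

/-- The translate `K + t`. -/
def setTranslate (K : Set ℝ) (t : ℝ) : Set ℝ := (fun x => x + t) '' K

/-! A self-similar union has a map sending some point to its left end. If that map preserves
orientation, its iterates embed the whole union in the leftmost copy of `K`; if it reverses
orientation, it puts a scaled copy of `1 - K` into `K`. Everything then rests on rigidity of affine
copies inside `K`: a copy cannot jump over a gap longer than all of its own, so it descends into a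
first-level piece and can be rescaled.

(i) By `BinaryCantor.scalesInto_classify` a copy of `K` in `K` has ratio `a ^ i * b ^ j`, with `j =
0` exactly for offset `0`. All translates are embedded with one ratio `r`: the leftmost gives `r = a
^ i`, any other gives `j ≠ 0`, contradicting irrationality. Reflected copies are excluded because
the longest gap is unique and `a ≠ b`.

(ii) Copies of `K` with ratio a power of `l` are cylinders (`exists_word`), and copies with offset
`0` have such ratios (`exists_eq_pow`). Working at both ends, `exists_offset_word` writes a multiple
`l ^ M * t` as a cylinder endpoint for `K` and for `1 - K`; comparing coefficients of `z` over
`ℚ(l)` shows that `t` has no `z`-part, whence `t > 2`. Now take a map whose image contains the left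
end of the deep cylinder `1 ^ N`. Isolation of that cylinder forces its ratio to be `l ^ k`, with `k
≤ N` for `N` large. It maps `K` and `K + t` onto two cylinders of `K` with equal `z`-weight, one of
them `1 ^ k`. That word alone has maximal weight, so the cylinders coincide and `t = 0`. -/

/-- The reflection `1 - K`. -/
def unitReflect (K : Set ℝ) : Set ℝ := {x | 1 - x ∈ K}

/-! ### Gaps and affine copies -/

/-- `K` lies in `[0, 1]`, contains both endpoints, and every complementary interval inside `[0, 1]`
has length at most `G`. -/
structure GapsLE (K : Set ℝ) (G : ℝ) : Prop where
  nonneg : ∀ x ∈ K, 0 ≤ x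
  le_one : ∀ x ∈ K, x ≤ 1
  zero_mem : (0 : ℝ) ∈ K
  one_mem : (1 : ℝ) ∈ K
  gap_le : ∀ u v : ℝ, 0 ≤ u → u < v → v ≤ 1 → (∀ x ∈ K, x ≤ u ∨ v ≤ x) → v - u ≤ G

/-- The affine map `x ↦ r x + s` sends `L` into `K`. -/
def ScalesInto (L K : Set ℝ) (r s : ℝ) : Prop := ∀ x ∈ L, r * x + s ∈ K

/-- An affine copy `r L + s` with gaps of relative size at most `G` cannot jump over an interval of
length `v - u > r G`. -/
lemma GapsLE.gap_le_mul {L K : Set ℝ} {G r s u v : ℝ} (hL : GapsLE L G) (hr : 0 < r)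
    (h : ScalesInto L K r s) (huv : u < v) (hK : ∀ x ∈ K, x ≤ u ∨ v ≤ x) (hu : s ≤ u)
    (hv : v ≤ r + s) : v - u ≤ r * G := by
  have := hL.gap_le ((u - s) / r) ((v - s) / r) (by apply div_nonneg <;> linarith)
    (by gcongr) (by rw [div_le_one hr]; linarith) (fun x hx => by
      rw [le_div_iff₀ hr, div_le_iff₀ hr]
      rcases hK _ (h x hx) with h | h
      · left; linarith
      · right; linarith)
  rw [← sub_div, div_le_iff₀ hr] at this
  linarith

lemma ScalesInto.offset_mem {L K : Set ℝ} {r s : ℝ} (h : ScalesInto L K r s) (h0 : (0 : ℝ) ∈ L) :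
    s ∈ K := by
  simpa using h 0 h0

lemma ScalesInto.end_mem {L K : Set ℝ} {r s : ℝ} (h : ScalesInto L K r s) (h1 : (1 : ℝ) ∈ L) :
    r + s ∈ K := by
  simpa using h 1 h1

/-- At the left end of a self-similar set there is either an arbitrarily strong contraction into the
set fixing the left end, or an orientation-reversing map into the set sending the right end to the
left end. -/
lemma exists_map_left_end {U : Set ℝ} {n : ℕ} {f : Fin n → ℝ → ℝ}
    (hf : ∀ i, IsContractiveSimilitude (f i)) (hU : U = ⋃ i, f i '' U) {A B : ℝ} (hA : A ∈ U)
    (hB : B ∈ U) (hlo : ∀ u ∈ U, A ≤ u) (hhi : ∀ u ∈ U, u ≤ B) {δ : ℝ} (hδ : 0 < δ) :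
    (∃ r, 0 < r ∧ r < 1 ∧ r * (B - A) < δ ∧ ∀ u ∈ U, A + r * (u - A) ∈ U) ∨
      ∃ r, 0 < r ∧ ∀ u ∈ U, A + r * (B - u) ∈ U := by
  have hmaps : ∀ i, ∀ u ∈ U, f i u ∈ U := fun i u hu => by
    rw [hU]; exact Set.mem_iUnion.2 ⟨i, u, hu, rfl⟩
  have hA' := hA
  rw [hU] at hA'
  obtain ⟨i, y, hy, hiy⟩ := Set.mem_iUnion.1 hA'
  obtain ⟨r, a, hr0, hr1, hfi⟩ := hf i
  have hfA := hlo _ (hmaps i A hA)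
  have hfB := hlo _ (hmaps i B hB)
  rw [hfi] at hfA hfB hiy
  have hyA := hlo y hy
  have hyB := hhi y hy
  rcases lt_or_gt_of_ne (abs_pos.1 hr0) with hneg | hpos
  · right
    refine ⟨-r, by linarith, fun u hu => ?_⟩
    have : A + -r * (B - u) = f i u := by rw [hfi]; nlinarith
    rw [this]; exact hmaps i u hu
  · left
    rw [abs_of_pos hpos] at hr1
    have hfix : r * A + a = A := by nlinarith
    have hstep : ∀ u ∈ U, A + r * (u - A) ∈ U := fun u hu => by
      have : A + r * (u - A) = f i u := by rw [hfi]; linarith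
      rw [this]; exact hmaps i u hu
    have hpow : ∀ k : ℕ, ∀ u ∈ U, A + r ^ k * (u - A) ∈ U := by
      intro k
      induction k with
      | zero => intro u hu; simpa using hu
      | succ k ih =>
        intro u hu
        have := hstep _ (ih u hu)
        rwa [add_sub_cancel_left, ← mul_assoc, ← pow_succ'] at this
    have hBA : 0 ≤ B - A := by linarith
    obtain ⟨k, hk⟩ := exists_pow_lt_of_lt_one (div_pos hδ (by linarith : 0 < B - A + 1)) hr1
    rw [lt_div_iff₀ (by linarith)] at hk
    have hk0 : 0 < r ^ k := by positivity
    -- The exponent is `k + 1` because `k = 0` would give ratio `1`.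
    refine ⟨r ^ (k + 1), by positivity, pow_lt_one₀ hpos.le hr1 (by omega), ?_, hpow _⟩
    have : r ^ (k + 1) ≤ r ^ k := pow_le_pow_of_le_one hpos.le hr1.le (by omega)
    nlinarith

/-! ### Two-map Cantor sets and part (i) -/

/-- The basic properties of the attractor of `x ↦ a x`, `x ↦ b x + 1 - b`. -/
structure BinaryCantor (a b : ℝ) (K : Set ℝ) : Prop where
  left_pos : 0 < a
  right_pos : 0 < b
  add_lt_one : a + b < 1
  nonneg : ∀ x ∈ K, 0 ≤ x
  le_one : ∀ x ∈ K, x ≤ 1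
  zero_mem : (0 : ℝ) ∈ K
  one_mem : (1 : ℝ) ∈ K
  left_mem : ∀ x ∈ K, a * x ∈ K
  right_mem : ∀ x ∈ K, b * x + 1 - b ∈ K
  mem_cases : ∀ x ∈ K, (∃ y ∈ K, x = a * y) ∨ ∃ y ∈ K, x = b * y + 1 - b

lemma BinaryCantor.of_isAttractor {a b : ℝ} (ha : 0 < a) (hb : 0 < b) (hab : a + b < 1) {K : Set ℝ}
    (hK : IsAttractor ![fun x : ℝ => a * x, fun x : ℝ => b * x + 1 - b] K) :
    BinaryCantor a b K := by
  obtain ⟨hne, hc, hEq⟩ := hK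
  have hmem : ∀ x, x ∈ K ↔ (∃ y ∈ K, x = a * y) ∨ ∃ y ∈ K, x = b * y + 1 - b := fun x => by
    conv_lhs => rw [hEq]
    simp [Set.mem_iUnion, Fin.exists_fin_two, eq_comm]
  have hl : ∀ x ∈ K, a * x ∈ K := fun x hx => (hmem _).2 (Or.inl ⟨x, hx, rfl⟩)
  have hr : ∀ x ∈ K, b * x + 1 - b ∈ K := fun x hx => (hmem _).2 (Or.inr ⟨x, hx, rfl⟩)
  obtain ⟨m, hm, hmin⟩ := hc.exists_isLeast hne
  obtain ⟨M, hM, hmax⟩ := hc.exists_isGreatest hne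
  have hm1 : m ≤ 0 := by nlinarith [hmin (hl m hm)]
  have hM1 : 1 ≤ M := by nlinarith [hmax (hr M hM)]
  have hm0 : m = 0 := by
    rcases (hmem m).1 hm with ⟨y, hy, h⟩ | ⟨y, hy, h⟩ <;> have := hmin hy <;> nlinarith
  have hM0 : M = 1 := by
    rcases (hmem M).1 hM with ⟨y, hy, h⟩ | ⟨y, hy, h⟩ <;> have := hmax hy <;> nlinarith
  subst hm0 hM0
  exact ⟨ha, hb, hab, fun x hx => hmin hx, fun x hx => hmax hx, hm, hM, hl, hr,
    fun x hx => (hmem x).1 hx⟩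

namespace BinaryCantor

variable {a b : ℝ} {K : Set ℝ}

lemma reflect (h : BinaryCantor a b K) : BinaryCantor b a (unitReflect K) where
  left_pos := h.right_pos
  right_pos := h.left_pos
  add_lt_one := by linarith [h.add_lt_one]
  nonneg x hx := by linarith [h.le_one _ hx]
  le_one x hx := by linarith [h.nonneg _ hx]
  zero_mem := by simpa [unitReflect] using h.one_mem
  one_mem := by simpa [unitReflect] using h.zero_mem
  left_mem x hx := by
    have := h.right_mem _ hx
    simp only [unitReflect, Set.mem_ofPred_eq]; convert this using 1; ring
  right_mem x hx := by
    have := h.left_mem _ hx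
    simp only [unitReflect, Set.mem_ofPred_eq]; convert this using 1; ring
  mem_cases x hx := by
    rcases h.mem_cases _ hx with ⟨y, hy, e⟩ | ⟨y, hy, e⟩
    · exact Or.inr ⟨1 - y, by simpa [unitReflect] using hy, by linarith⟩
    · exact Or.inl ⟨1 - y, by simpa [unitReflect] using hy, by linarith⟩

lemma div_left_mem (h : BinaryCantor a b K) {x : ℝ} (hx : x ∈ K) (hxa : x < 1 - b) :
    x / a ∈ K := by
  have ha := h.left_pos
  rcases h.mem_cases x hx with ⟨y, hy, rfl⟩ | ⟨y, hy, rfl⟩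
  · rwa [mul_div_cancel_left₀ _ ha.ne']
  · nlinarith [h.nonneg y hy, h.right_pos]

lemma div_right_mem (h : BinaryCantor a b K) {x : ℝ} (hx : x ∈ K) (hxa : a < x) :
    (x - (1 - b)) / b ∈ K := by
  have hb := h.right_pos
  rcases h.mem_cases x hx with ⟨y, hy, rfl⟩ | ⟨y, hy, rfl⟩
  · nlinarith [h.le_one y hy, h.left_pos]
  · have : (b * y + 1 - b - (1 - b)) / b = y := by field_simp; ring
    rwa [this]

lemma le_or_ge (h : BinaryCantor a b K) {x : ℝ} (hx : x ∈ K) : x ≤ a ∨ 1 - b ≤ x := by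
  rcases h.mem_cases x hx with ⟨y, hy, rfl⟩ | ⟨y, hy, rfl⟩
  · left; nlinarith [h.le_one y hy, h.left_pos]
  · right; nlinarith [h.nonneg y hy, h.right_pos]

/-- The central gap is the unique longest one. -/
lemma gap_le_and_eq (h : BinaryCantor a b K) (n : ℕ) : ∀ u v : ℝ, 0 ≤ u → u < v → v ≤ 1 →
    (max a b) ^ n < v - u → (∀ x ∈ K, x ≤ u ∨ v ≤ x) →
      v - u ≤ 1 - a - b ∧ (v - u = 1 - a - b → u = a) := by
  have ha := h.left_pos
  have hb := h.right_pos
  have hab := h.add_lt_one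
  induction n with
  | zero => intro u v hu huv hv hn; simp at hn; linarith
  | succ n ih =>
    intro u v hu huv hv hn hgap
    have hm : 0 < max a b := lt_max_of_lt_left ha
    have hmn : 0 < (max a b) ^ n := by positivity
    rw [pow_succ] at hn
    rcases hgap a (by simpa using h.left_mem 1 h.one_mem) with h1 | h1
    · rcases hgap (1 - b) (by simpa using h.right_mem 0 h.zero_mem) with h2 | h2
      -- A gap inside a first-level piece is at most `a` or `b` times the central one, so the
      -- equality clause is vacuous there.
      · have := ih ((u - (1 - b)) / b) ((v - (1 - b)) / b) (div_nonneg (by linarith) hb.le)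
          (by gcongr) (by rw [div_le_one hb]; linarith)
          (by rw [← sub_div, lt_div_iff₀ hb]; nlinarith [le_max_right a b])
          (fun x hx => by
            rw [le_div_iff₀ hb, div_le_iff₀ hb]
            rcases hgap _ (h.right_mem x hx) with h | h
            · left; linarith
            · right; linarith)
        rw [← sub_div, div_le_iff₀ hb] at this
        constructor
        · nlinarith [this.1]
        · intro e; nlinarith [this.1]
      · exact ⟨by linarith, fun e => by linarith⟩
    · have := ih (u / a) (v / a) (div_nonneg (by linarith) ha.le)
          (by gcongr) (by rw [div_le_one ha]; linarith)
          (by rw [← sub_div, lt_div_iff₀ ha]; nlinarith [le_max_left a b])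
          (fun x hx => by
            rw [le_div_iff₀ ha, div_le_iff₀ ha]
            rcases hgap _ (h.left_mem x hx) with h | h
            · left; linarith
            · right; linarith)
      rw [← sub_div, div_le_iff₀ ha] at this
      constructor
      · nlinarith [this.1]
      · intro e; nlinarith [this.1]

lemma max_lt_one (h : BinaryCantor a b K) : max a b < 1 :=
  max_lt (by linarith [h.right_pos, h.add_lt_one]) (by linarith [h.left_pos, h.add_lt_one])

lemma gapsLE (h : BinaryCantor a b K) : GapsLE K (1 - a - b) :=
  ⟨h.nonneg, h.le_one, h.zero_mem, h.one_mem, fun u v hu huv hv hg => by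
    obtain ⟨n, hn⟩ := exists_pow_lt_of_lt_one (sub_pos.2 huv) h.max_lt_one
    exact (h.gap_le_and_eq n u v hu huv hv hn hg).1⟩

/-- An affine copy in a binary Cantor set of a set whose gaps are not longer than the central gap is
the image of that set under a composition of the two maps. -/
lemma scalesInto_classify (h : BinaryCantor a b K) {L : Set ℝ} (hL : GapsLE L (1 - a - b)) (n : ℕ) :
    ∀ r s : ℝ, (max a b) ^ n < r → ScalesInto L K r s →
      (∀ x ∈ L, x ∈ K) ∧ ∃ i j : ℕ, r = a ^ i * b ^ j ∧ (j = 0 ↔ s = 0) := by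
  have ha := h.left_pos
  have hb := h.right_pos
  have hab := h.add_lt_one
  have hbase : ∀ r s : ℝ, 1 ≤ r → ScalesInto L K r s →
      (∀ x ∈ L, x ∈ K) ∧ ∃ i j : ℕ, r = a ^ i * b ^ j ∧ (j = 0 ↔ s = 0) := by
    intro r s hr hrs
    have h0 := h.nonneg _ (hrs.offset_mem hL.zero_mem)
    have h1 := h.le_one _ (hrs.end_mem hL.one_mem)
    have hs : s = 0 := by linarith
    have hr : r = 1 := by linarith
    subst hs hr
    exact ⟨fun x hx => by simpa using hrs x hx, 0, 0, by simp, by simp⟩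
  induction n with
  | zero => intro r s hr hrs; exact hbase r s (by simpa using hr.le) hrs
  | succ n ih =>
    intro r s hr hrs
    rcases le_or_gt 1 r with h1 | h1
    · exact hbase r s h1 hrs
    have hm : 0 < max a b := lt_max_of_lt_left ha
    have hmn : 0 < (max a b) ^ n := by positivity
    have hr0 : 0 < r := lt_trans (by positivity) hr
    rw [pow_succ] at hr
    have hs := hrs.offset_mem hL.zero_mem
    have he := hrs.end_mem hL.one_mem
    rcases h.le_or_ge hs with h2 | h2
    · rcases h.le_or_ge he with h3 | h3
      · obtain ⟨hsub, i, j, hij, hj⟩ := ih (r / a) (s / a)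
          (by rw [lt_div_iff₀ ha]; nlinarith [le_max_left a b])
          (fun x hx => by
            have := h.div_left_mem (hrs x hx) (by nlinarith [hL.le_one x hx])
            convert this using 1; ring)
        refine ⟨hsub, i + 1, j, ?_, ?_⟩
        · rw [div_eq_iff ha.ne'] at hij; rw [hij]; ring
        · rw [hj, div_eq_zero_iff]; simp [ha.ne']
      -- Straddling the central gap would require `1 - a - b ≤ r * (1 - a - b)` with `r < 1`.
      · have := hL.gap_le_mul hr0 hrs (by linarith) (fun x hx => h.le_or_ge hx) h2 h3
        nlinarith
    · obtain ⟨hsub, i, j, hij, hj⟩ := ih (r / b) ((s - (1 - b)) / b)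
          (by rw [lt_div_iff₀ hb]; nlinarith [le_max_right a b])
          (fun x hx => by
            have := h.div_right_mem (hrs x hx) (by nlinarith [hL.nonneg x hx])
            convert this using 1; ring)
      refine ⟨hsub, i, j + 1, ?_, ?_⟩
      · rw [div_eq_iff hb.ne'] at hij; rw [hij]; ring
      -- Here `s ≥ 1 - b > 0`, so both sides of the equivalence are false.
      · constructor
        · intro h; omega
        · intro h; linarith

lemma eq_of_scalesInto (h : BinaryCantor a b K) {L : Set ℝ} (hL : GapsLE L (1 - a - b)) {r s : ℝ}
    (hr : 0 < r) (hrs : ScalesInto L K r s) :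
      (∀ x ∈ L, x ∈ K) ∧ ∃ i j : ℕ, r = a ^ i * b ^ j ∧ (j = 0 ↔ s = 0) := by
  obtain ⟨n, hn⟩ := exists_pow_lt_of_lt_one hr h.max_lt_one
  exact h.scalesInto_classify hL n r s hn hrs

/-- Such a copy would give `1 - K ⊆ K`. Then `(a, 1 - b)` is a longest gap of `1 - K`, and the only
one of these starts at `b`. -/
lemma not_scalesInto_reflect (h : BinaryCantor a b K) (hne : a ≠ b) {r s : ℝ} (hr : 0 < r) :
    ¬ ScalesInto (unitReflect K) K r s := by
  intro hrs
  have hR := h.reflect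
  have hG : GapsLE (unitReflect K) (1 - a - b) := by
    have := hR.gapsLE; rwa [sub_right_comm] at this
  have hsub := (h.eq_of_scalesInto hG hr hrs).1
  have hab := h.add_lt_one
  obtain ⟨n, hn⟩ := exists_pow_lt_of_lt_one (show 0 < 1 - b - a by linarith) hR.max_lt_one
  exact hne ((hR.gap_le_and_eq n a (1 - b) h.left_pos.le (by linarith) (by linarith [h.right_pos])
    hn (fun x hx => h.le_or_ge (hsub x hx))).2 rfl)

/-- `1 - b ^ N z` belongs to the attractor whenever `1 - z` does. -/
lemma one_sub_pow_mem (h : BinaryCantor a b K) {z : ℝ} (hz : z ∈ unitReflect K) (N : ℕ) :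
    1 - b ^ N * z ∈ K := by
  induction N with
  | zero => simpa [unitReflect] using hz
  | succ N ih =>
    have := h.right_mem _ ih
    convert this using 1; ring

end BinaryCantor

/-- Logarithms give `(i - i') log a = j log b`, a rational relation unless `j = 0`. -/
lemma pow_mul_pow_ne_of_irrational {a b : ℝ} (ha : 0 < a) (hb : 0 < b)
    (hirr : Irrational (Real.log a / Real.log b)) {i i' j : ℕ} (h : a ^ i = a ^ i' * b ^ j) :
    j = 0 := by
  by_contra hj
  have hlb : Real.log b ≠ 0 := by
    intro h0; rw [h0, div_zero] at hirr; exact not_irrational_zero hirr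
  have h1 := congrArg Real.log h
  rw [Real.log_mul (by positivity) (by positivity), Real.log_pow, Real.log_pow, Real.log_pow] at h1
  have hj' : (j : ℝ) ≠ 0 := by exact_mod_cast hj
  have hii : (i : ℝ) - i' ≠ 0 := by
    intro h0
    have : (j : ℝ) * Real.log b = 0 := by linear_combination -h1 + Real.log a * h0
    exact (mul_ne_zero hj' hlb) this
  apply hirr
  refine ⟨(j : ℚ) / ((i : ℚ) - i'), ?_⟩
  push_cast
  field_simp
  linear_combination -h1

theorem not_isSelfSimilarSet_iUnion_translate {a b : ℝ} {K : Set ℝ} (h : BinaryCantor a b K)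
    (hirr : Irrational (Real.log a / Real.log b)) {m : ℕ} (hm : 1 ≤ m) {t : Fin (m + 1) → ℝ}
    (ht : Function.Injective t) : ¬ IsSelfSimilarSet (⋃ j, setTranslate K (t j)) := by
  rintro ⟨n, f, hf, -, -, hU⟩
  set U := ⋃ j, setTranslate K (t j) with hUdef
  have hmemU : ∀ u, u ∈ U ↔ ∃ j, u - t j ∈ K := fun u => by
    rw [hUdef, Set.mem_iUnion]
    refine exists_congr fun j => ⟨?_, fun h => ⟨_, h, by simp⟩⟩
    rintro ⟨x, hx, rfl⟩; simpa using hx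
  have hab : a ≠ b := by
    rintro rfl
    rcases eq_or_ne (Real.log a) 0 with h0 | h0
    · rw [h0, div_zero] at hirr; exact not_irrational_zero hirr
    · rw [div_self h0] at hirr; exact not_irrational_one hirr
  obtain ⟨p, hp⟩ := Finite.exists_min t
  obtain ⟨q, hq⟩ := Finite.exists_max t
  obtain ⟨δ, hδ, hδt⟩ : ∃ δ : ℝ, 0 < δ ∧ ∀ j, j ≠ p → t p + δ ≤ t j := by
    have : Nonempty {j // j ≠ p} := by
      have : Nontrivial (Fin (m + 1)) := Fin.nontrivial_iff_two_le.2 (by omega)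
      obtain ⟨j, hj⟩ := exists_ne p
      exact ⟨⟨j, hj⟩⟩
    obtain ⟨j, hj⟩ := Finite.exists_min (fun j : {j // j ≠ p} => t j)
    refine ⟨t j - t p, sub_pos.2 (lt_of_le_of_ne (hp j) (fun e => j.2 (ht e).symm)), fun k hk => ?_⟩
    have := hj ⟨k, hk⟩
    simp only at this
    linarith
  -- Within `δ` of its left end the union consists of the leftmost translate alone.
  have hloc : ∀ u ∈ U, u < t p + δ → u - t p ∈ K := by
    intro u hu hlt
    obtain ⟨j, hj⟩ := (hmemU u).1 hu
    by_cases hjp : j = p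
    · rwa [hjp] at hj
    · linarith [hδt j hjp, h.nonneg _ hj]
  have hA : t p ∈ U := (hmemU _).2 ⟨p, by simpa using h.zero_mem⟩
  have hB : t q + 1 ∈ U := (hmemU _).2 ⟨q, by simpa using h.one_mem⟩
  have hlo : ∀ u ∈ U, t p ≤ u := fun u hu => by
    obtain ⟨j, hj⟩ := (hmemU u).1 hu
    linarith [h.nonneg _ hj, hp j]
  have hhi : ∀ u ∈ U, u ≤ t q + 1 := fun u hu => by
    obtain ⟨j, hj⟩ := (hmemU u).1 hu
    linarith [h.le_one _ hj, hq j]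
  rcases exists_map_left_end hf hU hA hB hlo hhi hδ with ⟨r, hr0, hr1, hrδ, hr⟩ | ⟨r, hr0, hr⟩
  · have hemb : ∀ j, ScalesInto K K r (r * (t j - t p)) := fun j x hx => by
      have hxU : x + t j ∈ U := (hmemU _).2 ⟨j, by simpa using hx⟩
      have := hloc _ (hr _ hxU) (by nlinarith [hhi _ hxU])
      convert this using 1; ring
    obtain ⟨-, i, j, hij, hj⟩ := h.eq_of_scalesInto h.gapsLE hr0 (hemb p)
    rw [hj.2 (by simp), pow_zero, mul_one] at hij
    have : Nontrivial (Fin (m + 1)) := Fin.nontrivial_iff_two_le.2 (by omega)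
    obtain ⟨k, hk⟩ := exists_ne p
    obtain ⟨-, i', j', hij', hj'⟩ := h.eq_of_scalesInto h.gapsLE hr0 (hemb k)
    have h0 := hj'.1 (pow_mul_pow_ne_of_irrational h.left_pos h.right_pos hirr (hij ▸ hij'))
    rcases mul_eq_zero.1 h0 with h0 | h0
    · exact hr0.ne' h0
    · exact hk (ht (sub_eq_zero.1 h0))
  -- The right end of the last translate contains a copy of `K` of ratio `b ^ N`; for large `N` the
  -- reversing map carries it into the `δ`-neighbourhood of the left end.
  · obtain ⟨N, hN⟩ := exists_pow_lt_of_lt_one (div_pos hδ hr0)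
      (show b < 1 by linarith [h.left_pos, h.add_lt_one])
    rw [lt_div_iff₀ hr0] at hN
    have hb := h.right_pos
    refine h.not_scalesInto_reflect hab (r := r * b ^ N) (s := 0) (by positivity) fun z hz => ?_
    have hzU : t q + (1 - b ^ N * z) ∈ U :=
      (hmemU _).2 ⟨q, by simpa using h.one_sub_pow_mem hz N⟩
    have hz1 : z ≤ 1 := h.reflect.le_one z hz
    have : 0 < r * b ^ N := by positivity
    have := hloc _ (hr _ hzU) (by nlinarith)
    convert this using 1; ring

/-! ### Three-map Cantor sets: gaps that copies cannot jump -/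

/-- The basic properties of the attractor of `x ↦ l x`, `x ↦ l x + z`, `x ↦ l x + 1 - l`. -/
structure TernaryCantor (l z : ℝ) (K : Set ℝ) : Prop where
  pos : 0 < l
  lt_mid : l < z
  mid_lt : z < 1 - 2 * l
  nonneg : ∀ x ∈ K, 0 ≤ x
  le_one : ∀ x ∈ K, x ≤ 1
  zero_mem : (0 : ℝ) ∈ K
  one_mem : (1 : ℝ) ∈ K
  left_mem : ∀ x ∈ K, l * x ∈ K
  mid_mem : ∀ x ∈ K, l * x + z ∈ K
  right_mem : ∀ x ∈ K, l * x + 1 - l ∈ K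
  mem_cases : ∀ x ∈ K, (∃ y ∈ K, x = l * y) ∨ (∃ y ∈ K, x = l * y + z) ∨ ∃ y ∈ K, x = l * y + 1 - l

lemma TernaryCantor.of_isAttractor {l z : ℝ} (hl : 0 < l) (hlz : l < z) (hz : z < 1 - 2 * l)
    {K : Set ℝ} (hK : IsAttractor ![fun x : ℝ => l * x, fun x : ℝ => l * x + z,
      fun x : ℝ => l * x + 1 - l] K) : TernaryCantor l z K := by
  obtain ⟨hne, hc, hEq⟩ := hK
  have hmem : ∀ x, x ∈ K ↔
      (∃ y ∈ K, x = l * y) ∨ (∃ y ∈ K, x = l * y + z) ∨ ∃ y ∈ K, x = l * y + 1 - l := fun x => by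
    conv_lhs => rw [hEq]
    simp [Set.mem_iUnion, Fin.exists_fin_succ, eq_comm]
  have h0 : ∀ x ∈ K, l * x ∈ K := fun x hx => (hmem _).2 (Or.inl ⟨x, hx, rfl⟩)
  have h1 : ∀ x ∈ K, l * x + z ∈ K := fun x hx => (hmem _).2 (Or.inr (Or.inl ⟨x, hx, rfl⟩))
  have h2 : ∀ x ∈ K, l * x + 1 - l ∈ K := fun x hx => (hmem _).2 (Or.inr (Or.inr ⟨x, hx, rfl⟩))
  obtain ⟨m, hm, hmin⟩ := hc.exists_isLeast hne
  obtain ⟨M, hM, hmax⟩ := hc.exists_isGreatest hne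
  have hm1 : m ≤ 0 := by nlinarith [hmin (h0 m hm)]
  have hM1 : 1 ≤ M := by nlinarith [hmax (h2 M hM)]
  have hm0 : m = 0 := by
    rcases (hmem m).1 hm with ⟨y, hy, h⟩ | ⟨y, hy, h⟩ | ⟨y, hy, h⟩ <;> have := hmin hy <;> nlinarith
  have hM0 : M = 1 := by
    rcases (hmem M).1 hM with ⟨y, hy, h⟩ | ⟨y, hy, h⟩ | ⟨y, hy, h⟩ <;> have := hmax hy <;> nlinarith
  subst hm0 hM0
  exact ⟨hl, hlz, hz, fun x hx => hmin hx, fun x hx => hmax hx, hm, hM, h0, h1, h2,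
    fun x hx => (hmem x).1 hx⟩

namespace TernaryCantor

variable {l z : ℝ} {K : Set ℝ}

lemma reflect (h : TernaryCantor l z K) : TernaryCantor l (1 - l - z) (unitReflect K) where
  pos := h.pos
  lt_mid := by linarith [h.mid_lt]
  mid_lt := by linarith [h.lt_mid]
  nonneg x hx := by linarith [h.le_one _ hx]
  le_one x hx := by linarith [h.nonneg _ hx]
  zero_mem := by simpa [unitReflect] using h.one_mem
  one_mem := by simpa [unitReflect] using h.zero_mem
  left_mem x hx := by
    have := h.right_mem _ hx
    simp only [unitReflect, Set.mem_ofPred_eq]; convert this using 1; ring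
  mid_mem x hx := by
    have := h.mid_mem _ hx
    simp only [unitReflect, Set.mem_ofPred_eq]; convert this using 1; ring
  right_mem x hx := by
    have := h.left_mem _ hx
    simp only [unitReflect, Set.mem_ofPred_eq]; convert this using 1; ring
  mem_cases x hx := by
    rcases h.mem_cases _ hx with ⟨y, hy, e⟩ | ⟨y, hy, e⟩ | ⟨y, hy, e⟩
    · exact Or.inr (Or.inr ⟨1 - y, by simpa [unitReflect] using hy, by linarith⟩)
    · exact Or.inr (Or.inl ⟨1 - y, by simpa [unitReflect] using hy, by linarith⟩)
    · exact Or.inl ⟨1 - y, by simpa [unitReflect] using hy, by linarith⟩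

lemma lt_third (h : TernaryCantor l z K) : l < 1 / 3 := by linarith [h.lt_mid, h.mid_lt]

lemma le_or_ge_first (h : TernaryCantor l z K) {x : ℝ} (hx : x ∈ K) : x ≤ l ∨ z ≤ x := by
  have := h.pos
  have := h.mid_lt
  rcases h.mem_cases x hx with ⟨y, hy, rfl⟩ | ⟨y, hy, rfl⟩ | ⟨y, hy, rfl⟩
  · left; nlinarith [h.le_one y hy]
  · right; nlinarith [h.nonneg y hy]
  · right; nlinarith [h.nonneg y hy]

lemma le_or_ge_second (h : TernaryCantor l z K) {x : ℝ} (hx : x ∈ K) : x ≤ z + l ∨ 1 - l ≤ x := by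
  have := h.pos
  have := h.lt_mid
  rcases h.mem_cases x hx with ⟨y, hy, rfl⟩ | ⟨y, hy, rfl⟩ | ⟨y, hy, rfl⟩
  · left; nlinarith [h.le_one y hy]
  · left; nlinarith [h.le_one y hy]
  · right; nlinarith [h.nonneg y hy]

lemma div_left_mem (h : TernaryCantor l z K) {x : ℝ} (hx : x ∈ K) (hxz : x < z) : x / l ∈ K := by
  have hl := h.pos
  have := h.mid_lt
  rcases h.mem_cases x hx with ⟨y, hy, rfl⟩ | ⟨y, hy, rfl⟩ | ⟨y, hy, rfl⟩
  · rwa [mul_div_cancel_left₀ _ hl.ne']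
  · nlinarith [h.nonneg y hy]
  · nlinarith [h.nonneg y hy]

lemma div_mid_mem (h : TernaryCantor l z K) {x : ℝ} (hx : x ∈ K) (h1 : l < x) (h2 : x < 1 - l) :
    (x - z) / l ∈ K := by
  have hl := h.pos
  rcases h.mem_cases x hx with ⟨y, hy, rfl⟩ | ⟨y, hy, rfl⟩ | ⟨y, hy, rfl⟩
  · nlinarith [h.le_one y hy]
  · rwa [add_sub_cancel_right, mul_div_cancel_left₀ _ hl.ne']
  · nlinarith [h.nonneg y hy]

lemma div_right_mem (h : TernaryCantor l z K) {x : ℝ} (hx : x ∈ K) (h1 : z + l < x) :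
    (x - (1 - l)) / l ∈ K := by
  have hl := h.pos
  have := h.lt_mid
  rcases h.mem_cases x hx with ⟨y, hy, rfl⟩ | ⟨y, hy, rfl⟩ | ⟨y, hy, rfl⟩
  · nlinarith [h.le_one y hy]
  · nlinarith [h.le_one y hy]
  · have : (l * y + 1 - l - (1 - l)) / l = y := by field_simp; ring
    rwa [this]

lemma mid_self_mem (h : TernaryCantor l z K) : z ∈ K := by simpa using h.mid_mem 0 h.zero_mem

/-- Every gap is at most as long as the longer one of the two first-level gaps. -/
lemma gap_le_of_pow_lt (h : TernaryCantor l z K) (n : ℕ) : ∀ u v : ℝ, 0 ≤ u → u < v → v ≤ 1 →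
    l ^ n < v - u → (∀ x ∈ K, x ≤ u ∨ v ≤ x) → v - u ≤ max (z - l) (1 - 2 * l - z) := by
  have hl := h.pos
  have hlz := h.lt_mid
  have hz := h.mid_lt
  have hM : 0 < max (z - l) (1 - 2 * l - z) := lt_max_of_lt_left (by linarith)
  have hM1 := le_max_left (z - l) (1 - 2 * l - z)
  have hM2 := le_max_right (z - l) (1 - 2 * l - z)
  induction n with
  | zero => intro u v hu huv hv hn; simp at hn; linarith
  | succ n ih =>
    intro u v hu huv hv hn hgap
    rw [pow_succ] at hn
    have key : ∀ d : ℝ, (∀ x ∈ K, l * x + d ∈ K) → d ≤ u → v ≤ l + d →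
        v - u ≤ max (z - l) (1 - 2 * l - z) := by
      intro d hd hdu hdv
      have := ih ((u - d) / l) ((v - d) / l) (div_nonneg (by linarith) hl.le)
        (by gcongr) (by rw [div_le_one hl]; linarith)
        (by rw [← sub_div, lt_div_iff₀ hl]; linarith)
        (fun x hx => by
          rw [le_div_iff₀ hl, div_le_iff₀ hl]
          rcases hgap _ (hd x hx) with h | h
          · left; linarith
          · right; linarith)
      rw [← sub_div, div_le_iff₀ hl] at this
      nlinarith
    rcases hgap l (by simpa using h.left_mem 1 h.one_mem) with h1 | h1
    · rcases hgap z h.mid_self_mem with h2 | h2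
      · rcases hgap (l + z) (by simpa using h.mid_mem 1 h.one_mem) with h3 | h3
        · rcases hgap (1 - l) (by simpa using h.right_mem 0 h.zero_mem) with h4 | h4
          · exact key (1 - l) (fun x hx => by rw [← add_sub_assoc]; exact h.right_mem x hx) h4
              (by linarith)
          · linarith
        · exact key z h.mid_mem h2 h3
      · linarith
    · exact key 0 (fun x hx => by simpa using h.left_mem x hx) hu (by linarith)

lemma gapsLE (h : TernaryCantor l z K) : GapsLE K (max (z - l) (1 - 2 * l - z)) :=
  ⟨h.nonneg, h.le_one, h.zero_mem, h.one_mem, fun u v hu huv hv hg => by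
    obtain ⟨n, hn⟩ := exists_pow_lt_of_lt_one (sub_pos.2 huv)
      (show l < 1 by linarith [h.lt_third])
    exact h.gap_le_of_pow_lt n u v hu huv hv hn hg⟩

/-- Inverts `j` iterations of the right-hand map on its rightmost cylinder. -/
lemma pow_right_mem (h : TernaryCantor l z K) (j : ℕ) :
    ∀ y ∈ K, 1 - l ^ j ≤ y → (y - 1) / l ^ j + 1 ∈ K := by
  have hl := h.pos
  have hl3 := h.lt_third
  induction j with
  | zero => intro y hy _; simpa using hy
  | succ j ih =>
    intro y hy hle
    have hj : l ^ j ≤ 1 := pow_le_one₀ hl.le (by linarith)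
    rw [pow_succ] at hle
    have := ih _ (h.div_right_mem hy (by nlinarith [h.mid_lt]))
      (by rw [le_div_iff₀ hl]; linarith)
    convert this using 1
    field_simp
    ring

/-- If the second gap is the longer one, then a strictly smaller copy does not jump over it. -/
lemma not_span_second (h : TernaryCantor l z K) {L : Set ℝ} (hL : GapsLE L (1 - 2 * l - z))
    {r s : ℝ} (hr : 0 < r) (hr1 : r < 1) (hs : ScalesInto L K r s) (h1 : s ≤ z + l)
    (h2 : 1 - l ≤ r + s) : False := by
  have hz := h.mid_lt
  have := hL.gap_le_mul hr hs (by linarith) (fun x hx => h.le_or_ge_second hx) h1 h2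
  nlinarith

lemma gapsLE_second (h : TernaryCantor l z K) (hg : z - l < 1 - 2 * l - z) :
    GapsLE K (1 - 2 * l - z) := by
  have := h.gapsLE
  rwa [max_eq_right hg.le] at this

/-- The second gap of a smaller copy with ratio a power of `l` does not cover the first gap. -/
lemma not_second_gap_covers_first (h : TernaryCantor l z K) (hg : z - l < 1 - 2 * l - z) {j : ℕ}
    {s : ℝ} (hs : ScalesInto K K (l ^ (j + 1)) s) (h1 : l ^ (j + 1) * (z + l) + s ≤ l)
    (h2 : z ≤ l ^ (j + 1) * (1 - l) + s) : False := by
  have hl := h.pos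
  have hl3 := h.lt_third
  have hlz := h.lt_mid
  have hz := h.mid_lt
  have hj0 : 0 < l ^ j := by positivity
  have hj1 : 0 < l ^ (j + 1) := by positivity
  have hjj : l ^ (j + 1) = l * l ^ j := pow_succ' l j
  -- The part of the copy left of its second gap lies in the rightmost cylinder of `l K` of size `l
  -- ^ (j + 1)`; blowing that cylinder up to unit size translates this part by `w`.
  set w := s / l ^ (j + 1) - 1 / l ^ j + 1 with hw
  have key : ∀ y, 0 ≤ y → y ≤ z + l → y ∈ K → y + w ∈ K := by
    intro y hy0 hy1 hy
    have hmem := hs y hy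
    have hlt : l ^ (j + 1) * y + s ≤ l := by nlinarith
    have := h.pow_right_mem j _ (h.div_left_mem hmem (by linarith))
      (by rw [le_div_iff₀ hl]; nlinarith)
    convert this using 1
    rw [hw, hjj]; field_simp; ring
  have e1 : ScalesInto K K l w := fun x hx =>
    key _ (by nlinarith [h.nonneg x hx]) (by nlinarith [h.le_one x hx]) (h.left_mem x hx)
  have e2 : ScalesInto K K l (w + z) := fun x hx => by
    have := key _ (by nlinarith [h.nonneg x hx]) (by nlinarith [h.le_one x hx]) (h.mid_mem x hx)
    convert this using 1; ring
  have hwl : l < w := by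
    have : w = (s - l + l ^ (j + 1)) / l ^ (j + 1) := by rw [hw, hjj]; field_simp
    rw [this, lt_div_iff₀ hj1]
    nlinarith
  have hG := h.gapsLE_second hg
  have n1 := fun a b => h.not_span_second hG hl (by linarith) e1 a b
  have n2 := fun a b => h.not_span_second hG hl (by linarith) e2 a b
  have b := h.le_one _ (e2.end_mem h.one_mem)
  -- The copy at `w` forces `w = z`. The copy at `w + z` must then start at or beyond `1 - l`, so `2
  -- * z ≥ 1 - l`, against `hg`.
  have hwz : z ≤ w := (h.le_or_ge_first (e1.offset_mem h.zero_mem)).resolve_left (by linarith)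
  have hw2 : w ≤ z + l := (h.le_or_ge_second (e1.offset_mem h.zero_mem)).resolve_right
    (by intro; linarith)
  have hw3 : l + w ≤ z + l := (h.le_or_ge_second (e1.end_mem h.one_mem)).resolve_right (n1 hw2)
  rcases h.le_or_ge_second (e2.offset_mem h.zero_mem) with h5 | h5
  · linarith
  · linarith

/-- A smaller copy with ratio a power of `l` does not jump over the first gap. -/
lemma not_span_first (h : TernaryCantor l z K) (hg : z - l < 1 - 2 * l - z) {k : ℕ} {s : ℝ}
    (hs : ScalesInto K K (l ^ (k + 1)) s) (h1 : s ≤ l) (h2 : z ≤ l ^ (k + 1) + s) : False := by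
  have hl := h.pos
  have hl3 := h.lt_third
  have hlz := h.lt_mid
  -- Neither gap of the copy can cover the first gap of `K`, so one of its three pieces jumps over
  -- it too. Iterating makes the jumping copy shorter than the gap.
  have claim : ∀ n : ℕ, ∃ s, ScalesInto K K (l ^ (k + n + 1)) s ∧ s ≤ l ∧
      z ≤ l ^ (k + n + 1) + s := by
    intro n
    induction n with
    | zero => exact ⟨s, hs, h1, h2⟩
    | succ n ih =>
      obtain ⟨s, hs, h1, h2⟩ := ih
      rw [show k + (n + 1) + 1 = (k + n + 1) + 1 by ring]
      have hp : l ^ (k + n + 1) < 1 := pow_lt_one₀ hl.le (by linarith) (by omega)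
      rw [pow_succ l (k + n + 1)]
      rcases h.le_or_ge_first (hs _ (h.left_mem 1 h.one_mem)) with c1 | c1
      swap
      · exact ⟨s, fun x hx => by
          have := hs _ (h.left_mem x hx)
          convert this using 1; ring, h1, by linarith⟩
      rcases h.le_or_ge_first (hs _ h.mid_self_mem) with c2 | c2
      swap
      · exfalso; nlinarith
      rcases h.le_or_ge_first (hs _ (h.mid_mem 1 h.one_mem)) with c3 | c3
      swap
      · exact ⟨l ^ (k + n + 1) * z + s, fun x hx => by
          have := hs _ (h.mid_mem x hx)
          convert this using 1; ring, c2, by linarith⟩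
      rcases h.le_or_ge_first (hs _ (h.right_mem 0 h.zero_mem)) with c4 | c4
      · exact ⟨l ^ (k + n + 1) * (1 - l) + s, fun x hx => by
          have := hs _ (h.right_mem x hx)
          convert this using 1; ring, by linarith, by linarith⟩
      · exact (h.not_second_gap_covers_first hg hs (by linarith) (by linarith)).elim
  obtain ⟨n, hn⟩ := exists_pow_lt_of_lt_one (sub_pos.2 hlz) (show l < 1 by linarith)
  obtain ⟨s, -, h1, h2⟩ := claim n
  have : l ^ (k + n + 1) ≤ l ^ n := pow_le_pow_of_le_one hl.le (by linarith) (by omega)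
  linarith

end TernaryCantor

/-! ### Words and cylinders -/

/-- The translation parts `0`, `z`, `1 - l` of the three maps. -/
def ternaryDigit (l z : ℝ) : Fin 3 → ℝ := ![0, z, 1 - l]

/-- The left endpoint of the cylinder coded by a word. -/
def ternaryValue (l z : ℝ) : List (Fin 3) → ℝ
  | [] => 0
  | i :: w => ternaryDigit l z i + l * ternaryValue l z w

namespace TernaryCantor

variable {l z : ℝ} {K : Set ℝ}

lemma digit_mem (h : TernaryCantor l z K) (i : Fin 3) {x : ℝ} (hx : x ∈ K) :
    l * x + ternaryDigit l z i ∈ K := by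
  fin_cases i
  · simpa [ternaryDigit] using h.left_mem x hx
  · simpa [ternaryDigit] using h.mid_mem x hx
  · simpa [ternaryDigit, add_sub_assoc] using h.right_mem x hx

lemma exists_digit_of_lt (h : TernaryCantor l z K) (hg : z - l < 1 - 2 * l - z) {k : ℕ} {s : ℝ}
    (hs : ScalesInto K K (l ^ (k + 1)) s) :
    ∃ i, ScalesInto K K (l ^ k) ((s - ternaryDigit l z i) / l) := by
  have hl := h.pos
  have hl3 := h.lt_third
  have hlz := h.lt_mid
  have hz := h.mid_lt
  have hp0 : 0 < l ^ (k + 1) := by positivity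
  have hp1 : l ^ (k + 1) < 1 := pow_lt_one₀ hl.le (by linarith) (by omega)
  have hs0 := hs.offset_mem h.zero_mem
  have hs1 := hs.end_mem h.one_mem
  have conv : ∀ d x : ℝ, l ^ k * x + (s - d) / l = (l ^ (k + 1) * x + s - d) / l := by
    intro d x; rw [pow_succ]; field_simp; ring
  have n2 := fun a b => h.not_span_second (h.gapsLE_second hg) hp0 hp1 hs a b
  rcases h.le_or_ge_first hs0 with h1 | h1
  · have h2 := (h.le_or_ge_first hs1).resolve_right (h.not_span_first hg hs h1)
    refine ⟨0, fun x hx => ?_⟩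
    rw [conv]
    simpa [ternaryDigit] using h.div_left_mem (hs x hx) (by nlinarith [h.le_one x hx])
  · rcases h.le_or_ge_second hs0 with h2 | h2
    · have h3 := (h.le_or_ge_second hs1).resolve_right (n2 h2)
      refine ⟨1, fun x hx => ?_⟩
      rw [conv]
      simpa [ternaryDigit] using h.div_mid_mem (hs x hx) (by nlinarith [h.nonneg x hx])
        (by nlinarith [h.le_one x hx])
    · refine ⟨2, fun x hx => ?_⟩
      rw [conv]
      simpa [ternaryDigit] using h.div_right_mem (hs x hx) (by nlinarith [h.nonneg x hx])

/-- Reflection reduces to the case where the second gap is the longer one; it reverses the digits.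
-/
lemma exists_digit (h : TernaryCantor l z K) (hne : 2 * z ≠ 1 - l) {k : ℕ} {s : ℝ}
    (hs : ScalesInto K K (l ^ (k + 1)) s) :
    ∃ i, ScalesInto K K (l ^ k) ((s - ternaryDigit l z i) / l) := by
  have hl := h.pos
  rcases lt_or_gt_of_ne (show z - l ≠ 1 - 2 * l - z by intro e; apply hne; linarith) with hg | hg
  · exact h.exists_digit_of_lt hg hs
  · have hs' : ScalesInto (unitReflect K) (unitReflect K) (l ^ (k + 1)) (1 - l ^ (k + 1) - s) :=
      fun x hx => by
        have := hs _ hx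
        simp only [unitReflect, Set.mem_ofPred_eq]; convert this using 1; ring
    obtain ⟨i, hi⟩ := h.reflect.exists_digit_of_lt (by linarith) hs'
    refine ⟨i.rev, fun x hx => ?_⟩
    have hd : ternaryDigit l z i.rev = 1 - l - ternaryDigit l (1 - l - z) i := by
      fin_cases i <;> simp [ternaryDigit, Fin.rev]
    have := hi (1 - x) (by simpa [unitReflect] using hx)
    simp only [unitReflect, Set.mem_ofPred_eq] at this
    rw [hd]
    convert this using 1
    rw [pow_succ]; field_simp; ring

/-- The copies of the attractor in itself whose ratio is a power of `l` are the cylinders. -/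
lemma exists_word (h : TernaryCantor l z K) (hne : 2 * z ≠ 1 - l) (k : ℕ) :
    ∀ s, ScalesInto K K (l ^ k) s → ∃ w : List (Fin 3), w.length = k ∧ s = ternaryValue l z w := by
  have hl := h.pos
  induction k with
  | zero =>
    intro s hs
    have h0 := h.nonneg _ (hs.offset_mem h.zero_mem)
    have h1 := h.le_one _ (hs.end_mem h.one_mem)
    rw [pow_zero] at h1
    exact ⟨[], rfl, by simp only [ternaryValue]; linarith⟩
  | succ k ih =>
    intro s hs
    obtain ⟨i, hi⟩ := h.exists_digit hne hs
    obtain ⟨w, hw, hv⟩ := ih _ hi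
    refine ⟨i :: w, by simp [hw], ?_⟩
    rw [ternaryValue, ← hv]; field_simp; ring

/-! ### Ratios of copies with offset zero -/

/-- Starting in the middle piece, the copy would have to jump the second gap or fit into length `l`;
in the right piece it is too long. -/
lemma offset_le_left (h : TernaryCantor l z K) {L : Set ℝ} (hL : GapsLE L (1 - 2 * l - z)) {r c : ℝ}
    (hr : l < r) (hr1 : r < 1) (hc : ScalesInto L K r c) : c ≤ l := by
  have hl := h.pos
  have hc0 := hc.offset_mem hL.zero_mem
  have hc1 := hc.end_mem hL.one_mem
  have hle := h.le_one _ hc1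
  rcases h.le_or_ge_first hc0 with h1 | h1
  · exact h1
  · rcases h.le_or_ge_second hc0 with h2 | h2
    · have := (h.le_or_ge_second hc1).resolve_right
        (h.not_span_second hL (by linarith) hr1 hc h2)
      linarith
    · linarith

/-- The middle piece of the copy straddles the first gap, since otherwise rescaling its middle or
right piece gives a copy starting beyond `l`. The right piece thus lies in the middle piece of `K`,
and rescaling yields a copy of the same ratio with a new offset. -/
lemma scalesInto_step (h : TernaryCantor l z K) {e : ℝ} {L : Set ℝ} (hT : TernaryCantor l e L)
    (hL : GapsLE L (1 - 2 * l - z)) {r c : ℝ} (hr : l < r) (hr1 : r < 1) (hc : ScalesInto L K r c) :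
    r * (1 - 2 * l - e) ≤ r * (1 - l) + c - z ∧ ScalesInto L K r ((r * (1 - l) + c - z) / l) := by
  have hl := h.pos
  have hlz := h.lt_mid
  have hle := hT.lt_mid
  have he := hT.mid_lt
  have hc0 := h.nonneg _ (hc.offset_mem hL.zero_mem)
  have hcl := h.offset_le_left hL hr hr1 hc
  have hend : r + c < 1 - l := lt_of_not_ge
    (h.not_span_second hL (by linarith) hr1 hc (by linarith))
  have hright : z ≤ r * (1 - l) + c → ScalesInto L K r ((r * (1 - l) + c - z) / l) := by
    intro hle x hx
    have hx0 := hT.nonneg x hx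
    have hx1 := hT.le_one x hx
    have hrl : 0 ≤ r * l := mul_nonneg (by linarith) hl.le
    have hp : 0 ≤ r * l * x := mul_nonneg hrl hx0
    have hp' : r * l * x ≤ r * l := mul_le_of_le_one_right hrl hx1
    have := h.div_mid_mem (hc _ (hT.right_mem x hx)) (by linarith) (by linarith)
    convert this using 1; field_simp; ring
  rcases h.le_or_ge_first (hc _ hT.mid_self_mem) with c1 | c1
  · rcases h.le_or_ge_first (hc _ (hT.mid_mem 1 hT.one_mem)) with c2 | c2
    · exfalso
      have hmid : ScalesInto L K r ((r * e + c) / l) := fun x hx => by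
        have hx1 := hT.le_one x hx
        have hp : r * l * x ≤ r * l := mul_le_of_le_one_right (by nlinarith) hx1
        have := h.div_left_mem (hc _ (hT.mid_mem x hx)) (by linarith)
        convert this using 1; field_simp; ring
      have := h.offset_le_left hL hr hr1 hmid
      rw [div_le_iff₀ hl] at this
      nlinarith
    · have hb : r * (1 - 2 * l - e) ≤ r * (1 - l) + c - z := by linarith
      exact ⟨hb, hright (by nlinarith)⟩
  · exfalso
    have := h.offset_le_left hL hr hr1 (hright (by nlinarith))
    rw [div_le_iff₀ hl] at this
    nlinarith

/-- No copy `r L` of a ternary Cantor set with the same ratio `l` and with gaps of at most the same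
size lies in `K`, unless `r` leaves the interval `(l, 1)`. -/
lemma not_scalesInto_of_lt (h : TernaryCantor l z K) {e : ℝ} {L : Set ℝ} (hT : TernaryCantor l e L)
    (hL : GapsLE L (max (z - l) (1 - 2 * l - z))) {r : ℝ} (hr : l < r) (hr1 : r < 1) :
    ¬ ScalesInto L K r 0 := by
  intro hs
  have hl := h.pos
  have hlz := h.lt_mid
  rcases le_total (1 - 2 * l - z) (z - l) with hg | hg
  · rw [max_eq_left hg] at hL
    have hrK : r ∈ K := by simpa using hs.end_mem hL.one_mem
    have := (h.le_or_ge_first hrK).resolve_left (by linarith)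
    have := hL.gap_le_mul (by linarith) hs hlz (fun x hx => h.le_or_ge_first hx) hl.le
      (by linarith)
    nlinarith
  · rw [max_eq_right hg] at hL
    have hbase := (h.scalesInto_step hT hL hr hr1 hs).1
    have hp : 0 < r * (1 - 2 * l - e) / l :=
      div_pos (mul_pos (by linarith) (by linarith [hT.mid_lt])) hl
    -- The bound `hbase` at offset `0` persists at offset `c` because `c * l ≤ c`, so each step adds
    -- a fixed positive amount to an offset that must stay in `[0, 1]`.
    have claim : ∀ n : ℕ, ∃ c, n * (r * (1 - 2 * l - e) / l) ≤ c ∧ ScalesInto L K r c := by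
      intro n
      induction n with
      | zero => exact ⟨0, by simp, hs⟩
      | succ n ih =>
        obtain ⟨c, hc, hcs⟩ := ih
        have hc0 := h.nonneg _ (hcs.offset_mem hL.zero_mem)
        refine ⟨_, ?_, (h.scalesInto_step hT hL hr hr1 hcs).2⟩
        have h1 : c + r * (1 - 2 * l - e) / l ≤ (r * (1 - l) + c - z) / l := by
          rw [le_div_iff₀ hl, add_mul, div_mul_cancel₀ _ hl.ne']
          nlinarith [h.lt_third]
        push_cast
        linarith
    obtain ⟨n, hn⟩ := exists_nat_gt (1 / (r * (1 - 2 * l - e) / l))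
    rw [div_lt_iff₀ hp] at hn
    obtain ⟨c, hc, hcs⟩ := claim n
    linarith [h.le_one _ (hcs.offset_mem hL.zero_mem)]

lemma scalesInto_div_pow (h : TernaryCantor l z K) {L : Set ℝ} (h1 : ∀ x ∈ L, x ≤ 1) (n : ℕ) :
    ∀ r, 0 < r → r ≤ l ^ n → ScalesInto L K r 0 → ScalesInto L K (r / l ^ n) 0 := by
  have hl := h.pos
  induction n with
  | zero => intro r _ _ hs; simpa using hs
  | succ n ih =>
    intro r hr0 hr hs
    have hn : l ^ n ≤ 1 := pow_le_one₀ hl.le (by linarith [h.lt_third])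
    rw [pow_succ] at hr
    have := ih (r / l) (by positivity) (by rwa [div_le_iff₀ hl]) (fun x hx => by
      have := h.div_left_mem (hs x hx) (by nlinarith [h.lt_mid, h1 x hx])
      convert this using 1; ring)
    rwa [div_div, ← pow_succ'] at this

lemma exists_eq_pow_of_scalesInto (h : TernaryCantor l z K) {e : ℝ} {L : Set ℝ}
    (hT : TernaryCantor l e L) (hL : GapsLE L (max (z - l) (1 - 2 * l - z))) {r : ℝ} (hr : 0 < r)
    (hs : ScalesInto L K r 0) : (∃ k : ℕ, r = l ^ k) ∧ ScalesInto L K 1 0 := by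
  have hl := h.pos
  have hr1 : r ≤ 1 := h.le_one _ (by simpa using hs.end_mem hL.one_mem)
  obtain ⟨n, hn1, hn2⟩ := exists_nat_pow_near_of_lt_one hr hr1 hl (by linarith [h.lt_third])
  have hdiv := h.scalesInto_div_pow hT.le_one n r hr hn2 hs
  have hp : 0 < l ^ n := by positivity
  rcases hn2.lt_or_eq with hlt | heq
  · exact (h.not_scalesInto_of_lt hT hL (by rw [lt_div_iff₀ hp, ← pow_succ']; exact hn1)
      (by rwa [div_lt_one hp]) hdiv).elim
  · rw [heq, div_self hp.ne'] at hdiv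
    exact ⟨⟨n, heq⟩, hdiv⟩

lemma exists_eq_pow (h : TernaryCantor l z K) {r : ℝ} (hr : 0 < r) (hs : ScalesInto K K r 0) :
    ∃ k : ℕ, r = l ^ k :=
  (h.exists_eq_pow_of_scalesInto h h.gapsLE hr hs).1

/-- It would give `1 - K ⊆ K`, but `1 - z` lies in the second gap or `1 - l - z` in the first,
according to the sign of `2 * z - (1 - l)`. -/
lemma not_scalesInto_reflect (h : TernaryCantor l z K) (hne : 2 * z ≠ 1 - l) {r : ℝ} (hr : 0 < r) :
    ¬ ScalesInto (unitReflect K) K r 0 := by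
  intro hs
  have hl := h.pos
  have hL : GapsLE (unitReflect K) (max (z - l) (1 - 2 * l - z)) := by
    have := h.reflect.gapsLE
    rwa [max_comm, show 1 - l - z - l = 1 - 2 * l - z by ring,
      show 1 - 2 * l - (1 - l - z) = z - l by ring] at this
  have h1 := (h.exists_eq_pow_of_scalesInto h.reflect hL hr hs).2
  have m1 := h1 (1 - z) (by simpa [unitReflect] using h.mid_self_mem)
  have m2 := h1 (1 - l - z) h.reflect.mid_self_mem
  rw [one_mul, add_zero] at m1 m2
  have := h.lt_mid
  have := h.mid_lt
  rcases lt_or_gt_of_ne hne with hg | hg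
  · rcases h.le_or_ge_second m1 with h | h <;> linarith
  · rcases h.le_or_ge_first m2 with h | h <;> linarith

end TernaryCantor

/-! ### Coefficients over `ℚ(l)` -/

/-- The coefficient of `z` in `ternaryValue l z`. -/
def midWeight (l : ℝ) : List (Fin 3) → ℝ
  | [] => 0
  | i :: w => (if i = 1 then 1 else 0) + l * midWeight l w

/-- The coefficient of `1 - l` in `ternaryValue l z`. -/
def rightWeight (l : ℝ) : List (Fin 3) → ℝ
  | [] => 0
  | i :: w => (if i = 2 then 1 else 0) + l * rightWeight l w

lemma ternaryValue_eq (l z : ℝ) (w : List (Fin 3)) :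
    ternaryValue l z w = midWeight l w * z + rightWeight l w * (1 - l) := by
  induction w with
  | nil => simp [ternaryValue, midWeight, rightWeight]
  | cons i w ih =>
    rw [ternaryValue, midWeight, rightWeight, ih]
    fin_cases i <;> simp [ternaryDigit] <;> ring

lemma midWeight_nonneg {l : ℝ} (hl : 0 < l) (w : List (Fin 3)) : 0 ≤ midWeight l w := by
  induction w with
  | nil => simp [midWeight]
  | cons i w ih => rw [midWeight]; split_ifs <;> positivity

lemma midWeight_mem (l : ℝ) (w : List (Fin 3)) :
    midWeight l w ∈ IntermediateField.adjoin ℚ ({l} : Set ℝ) := by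
  induction w with
  | nil => exact zero_mem _
  | cons i w ih =>
    rw [midWeight]
    refine add_mem ?_ (mul_mem (IntermediateField.mem_adjoin_simple_self ℚ l) ih)
    split_ifs
    exacts [one_mem _, zero_mem _]

lemma rightWeight_mem (l : ℝ) (w : List (Fin 3)) :
    rightWeight l w ∈ IntermediateField.adjoin ℚ ({l} : Set ℝ) := by
  induction w with
  | nil => exact zero_mem _
  | cons i w ih =>
    rw [rightWeight]
    refine add_mem ?_ (mul_mem (IntermediateField.mem_adjoin_simple_self ℚ l) ih)
    split_ifs
    exacts [one_mem _, zero_mem _]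

lemma coeff_eq_zero_of_notMem {F : IntermediateField ℚ ℝ} {z α β : ℝ} (hz : z ∉ F) (hα : α ∈ F)
    (hβ : β ∈ F) (h : α * z = β) : α = 0 := by
  by_contra h0
  apply hz
  rw [show z = β / α by rw [← h]; field_simp]
  exact div_mem hβ hα

lemma midWeight_le_replicate {l : ℝ} (hl : 0 < l) (w : List (Fin 3)) :
    midWeight l w ≤ midWeight l (List.replicate w.length 1) := by
  induction w with
  | nil => simp
  | cons i w ih =>
    rw [List.length_cons, List.replicate_succ, midWeight, midWeight]
    have := mul_le_mul_of_nonneg_left ih hl.le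
    rw [if_pos rfl]
    split_ifs <;> linarith

/-- Each letter contributes at most its power of `l`, with equality only for the letter `1`. -/
lemma eq_replicate_of_midWeight_eq {l : ℝ} (hl : 0 < l) (w : List (Fin 3))
    (h : midWeight l w = midWeight l (List.replicate w.length 1)) :
    w = List.replicate w.length 1 := by
  induction w with
  | nil => simp
  | cons i w ih =>
    rw [List.length_cons, List.replicate_succ, midWeight, midWeight, if_pos rfl] at h
    have hle := mul_le_mul_of_nonneg_left (midWeight_le_replicate hl w) hl.le
    split_ifs at h with hi
    · have := ih (mul_left_cancel₀ hl.ne' (by linarith))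
      rw [List.length_cons, List.replicate_succ, hi, ← this]
    · linarith

/-! ### Unions of two translates and part (ii) -/

/-- The union of `K` and `K + t`. -/
def twoCopies (K : Set ℝ) (t : ℝ) : Set ℝ := {u | u ∈ K ∨ u - t ∈ K}

lemma union_setTranslate (K : Set ℝ) (t : ℝ) : K ∪ setTranslate K t = twoCopies K t := by
  ext u
  simp only [setTranslate, twoCopies, Set.mem_union, Set.mem_image, Set.mem_ofPred_eq]
  refine or_congr Iff.rfl ⟨?_, fun h => ⟨_, h, by ring⟩⟩
  rintro ⟨x, hx, rfl⟩
  simpa using hx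

lemma mem_twoCopies_unitReflect {K : Set ℝ} {t u : ℝ} :
    u ∈ twoCopies (unitReflect K) t ↔ 1 + t - u ∈ twoCopies K t := by
  simp only [twoCopies, unitReflect, Set.mem_ofPred_eq]
  rw [or_comm, show 1 - (u - t) = 1 + t - u by ring, show 1 + t - u - t = 1 - u by ring]

namespace TernaryCantor

variable {l z : ℝ} {K : Set ℝ}

lemma pow_left_mem (h : TernaryCantor l z K) {x : ℝ} (hx : x ∈ K) (n : ℕ) : l ^ n * x ∈ K := by
  induction n with
  | zero => simpa using hx
  | succ n ih =>
    have := h.left_mem _ ih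
    rwa [← mul_assoc, ← pow_succ'] at this

lemma one_sub_pow_mem (h : TernaryCantor l z K) {x : ℝ} (hx : x ∈ unitReflect K) (n : ℕ) :
    1 - l ^ n * x ∈ K :=
  h.reflect.pow_left_mem hx n

lemma cylinder_mem (h : TernaryCantor l z K) {x : ℝ} (hx : x ∈ K) (w : List (Fin 3)) :
    l ^ w.length * x + ternaryValue l z w ∈ K := by
  induction w with
  | nil => simpa [ternaryValue] using hx
  | cons i w ih =>
    have := h.digit_mem i ih
    rw [List.length_cons, ternaryValue, pow_succ]
    convert this using 1; ring

lemma value_mem (h : TernaryCantor l z K) (w : List (Fin 3)) : ternaryValue l z w ∈ K := by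
  simpa using h.cylinder_mem h.zero_mem w

lemma exists_cylinder (h : TernaryCantor l z K) (n : ℕ) : ∀ y ∈ K,
    ∃ d, ScalesInto K K (l ^ n) d ∧ ∃ x ∈ K, y = l ^ n * x + d := by
  induction n with
  | zero => intro y hy; exact ⟨0, fun x hx => by simpa using hx, y, hy, by simp⟩
  | succ n ih =>
    intro y hy
    obtain ⟨i, y', hy', e⟩ : ∃ i, ∃ y' ∈ K, y = l * y' + ternaryDigit l z i := by
      rcases h.mem_cases y hy with ⟨y', hy', e⟩ | ⟨y', hy', e⟩ | ⟨y', hy', e⟩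
      · exact ⟨0, y', hy', by simpa [ternaryDigit] using e⟩
      · exact ⟨1, y', hy', by simpa [ternaryDigit] using e⟩
      · exact ⟨2, y', hy', by simpa [ternaryDigit, add_sub_assoc] using e⟩
    obtain ⟨d, hd, x, hx, e'⟩ := ih y' hy'
    refine ⟨l * d + ternaryDigit l z i, fun x hx => ?_, x, hx, by rw [e, e', pow_succ]; ring⟩
    have := h.digit_mem i (hd x hx)
    rw [pow_succ]
    convert this using 1; ring

/-- The three first-level pieces are disjoint, so the address is read off letter by letter. -/
lemma prefix_eq_replicate (h : TernaryCantor l z K) {x : ℝ} (hx : x ∈ K) (w : List (Fin 3)) :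
    ∀ N : ℕ, w.length ≤ N →
      l ^ w.length * x + ternaryValue l z w = ternaryValue l z (List.replicate N 1) →
      w = List.replicate w.length 1 := by
  have hl := h.pos
  have hlz := h.lt_mid
  have hz := h.mid_lt
  induction w with
  | nil => intro N _ _; simp
  | cons i w ih =>
    intro N hN e
    rw [List.length_cons] at hN e ⊢
    obtain ⟨N, rfl⟩ : ∃ M, N = M + 1 := ⟨N - 1, by omega⟩
    rw [List.replicate_succ] at e ⊢
    rw [ternaryValue, ternaryValue, pow_succ] at e
    have m1 := h.cylinder_mem hx w
    have m2 := h.value_mem (List.replicate N 1)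
    have a1 := h.nonneg _ m1
    have a2 := h.le_one _ m1
    have b1 := h.nonneg _ m2
    have b2 := h.le_one _ m2
    set p := l ^ w.length * x + ternaryValue l z w with hp
    set q := ternaryValue l z (List.replicate N 1)
    have e' : ternaryDigit l z i + l * p = z + l * q := by
      have : ternaryDigit l z 1 = z := by simp [ternaryDigit]
      rw [this] at e; rw [← e, hp]; ring
    have hi : i = 1 := by
      fin_cases i
      · simp [ternaryDigit] at e'; nlinarith
      · rfl
      · simp [ternaryDigit] at e'; nlinarith
    subst hi
    have hpq : p = q := by
      have : ternaryDigit l z 1 = z := by simp [ternaryDigit]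
      rw [this] at e'
      exact mul_left_cancel₀ hl.ne' (by linarith)
    rw [← ih N (by omega) hpq]

/-- The cylinder `1 ^ N` is isolated in the attractor. -/
lemma sub_div_mem_of_close (h : TernaryCantor l z K) {δ : ℝ} (h1 : δ ≤ z - l)
    (h2 : δ ≤ 1 - 2 * l - z) (N : ℕ) :
    ∀ u ∈ K, |u - ternaryValue l z (List.replicate N 1)| < l ^ N * δ →
      (u - ternaryValue l z (List.replicate N 1)) / l ^ N ∈ K := by
  have hl := h.pos
  have hl3 := h.lt_third
  induction N with
  | zero => intro u hu _; simpa [ternaryValue] using hu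
  | succ N ih =>
    intro u hu hclose
    have hq := h.value_mem (List.replicate N 1)
    have hq0 := h.nonneg _ hq
    have hq1 := h.le_one _ hq
    have hd : ternaryDigit l z 1 = z := by simp [ternaryDigit]
    rw [List.replicate_succ, ternaryValue, hd] at hclose ⊢
    set q := ternaryValue l z (List.replicate N 1)
    have hδ : 0 < δ := by
      have := (abs_nonneg _).trans_lt hclose
      exact pos_of_mul_pos_right this (by positivity)
    have hp : l ^ (N + 1) ≤ 1 := pow_le_one₀ hl.le (by linarith)
    obtain ⟨c1, c2⟩ := abs_lt.1 hclose
    have c3 : l ^ (N + 1) * δ ≤ δ := by nlinarith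
    have c4 : 0 ≤ l * q := by positivity
    have c5 : l * q ≤ l := by nlinarith
    have := ih _ (h.div_mid_mem hu (by linarith) (by linarith)) (by
      rw [show (u - z) / l - q = (u - (z + l * q)) / l by field_simp; ring, abs_div,
        abs_of_pos hl, div_lt_iff₀ hl]
      rw [pow_succ] at hclose
      linarith)
    convert this using 1
    rw [pow_succ]; field_simp; ring

lemma exists_pow_mul_mem (h : TernaryCantor l z K) (hne : 2 * z ≠ 1 - l) {t : ℝ} (ht : 0 < t)
    {n : ℕ} {f : Fin n → ℝ → ℝ} (hf : ∀ i, IsContractiveSimilitude (f i))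
    (hU : twoCopies K t = ⋃ i, f i '' twoCopies K t) :
    ∃ m : ℕ, ∀ u ∈ twoCopies K t, l ^ m * u ∈ K := by
  have hl := h.pos
  have hlo : ∀ u ∈ twoCopies K t, 0 ≤ u := by
    rintro u (hu | hu) <;> linarith [h.nonneg _ hu]
  have hhi : ∀ u ∈ twoCopies K t, u ≤ 1 + t := by
    rintro u (hu | hu) <;> linarith [h.le_one _ hu]
  have hloc : ∀ u ∈ twoCopies K t, u < t → u ∈ K := by
    rintro u (hu | hu) hlt
    · exact hu
    · linarith [h.nonneg _ hu]
  rcases exists_map_left_end hf hU (Or.inl h.zero_mem) (B := 1 + t)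
      (Or.inr (by simpa using h.one_mem)) hlo hhi ht with ⟨r, hr0, -, hrt, hr⟩ | ⟨r, hr0, hr⟩
  · have hall : ∀ u ∈ twoCopies K t, r * u ∈ K := fun u hu => by
      have := hr u hu
      rw [sub_zero, zero_add] at this
      rw [sub_zero] at hrt
      exact hloc _ this (by nlinarith [hhi u hu])
    obtain ⟨k, rfl⟩ := h.exists_eq_pow hr0
      (fun x hx => by simpa using hall x (Or.inl hx))
    exact ⟨k, hall⟩
  · exfalso
    obtain ⟨N, hN⟩ := exists_pow_lt_of_lt_one (div_pos ht hr0)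
      (show l < 1 by linarith [h.lt_third])
    rw [lt_div_iff₀ hr0] at hN
    refine h.not_scalesInto_reflect hne (r := r * l ^ N) (by positivity) fun x hx => ?_
    have hxU : 1 - l ^ N * x + t ∈ twoCopies K t := Or.inr (by simpa using h.one_sub_pow_mem hx N)
    have hx1 := h.reflect.le_one x hx
    have hp : 0 < r * l ^ N := by positivity
    have := hloc _ (hr _ hxU) (by nlinarith)
    convert this using 1; ring

end TernaryCantor

lemma isContractiveSimilitude_reflect {f : ℝ → ℝ} (hf : IsContractiveSimilitude f) (c : ℝ) :
    IsContractiveSimilitude fun u => c - f (c - u) := by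
  obtain ⟨r, a, h0, h1, h⟩ := hf
  exact ⟨r, c - r * c - a, h0, h1, fun x => by simp only [h]; ring⟩

lemma twoCopies_unitReflect_eq_iUnion {K : Set ℝ} {t : ℝ} {n : ℕ} {f : Fin n → ℝ → ℝ}
    (hU : twoCopies K t = ⋃ i, f i '' twoCopies K t) :
    twoCopies (unitReflect K) t =
      ⋃ i, (fun u => 1 + t - f i (1 + t - u)) '' twoCopies (unitReflect K) t := by
  ext u
  rw [mem_twoCopies_unitReflect, hU, Set.mem_iUnion, Set.mem_iUnion]
  refine exists_congr fun i => ⟨?_, ?_⟩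
  · rintro ⟨y, hy, e⟩
    refine ⟨1 + t - y, ?_, ?_⟩
    · rw [mem_twoCopies_unitReflect, sub_sub_cancel]; exact hy
    · simp only [sub_sub_cancel, e]
  · rintro ⟨y, hy, rfl⟩
    exact ⟨1 + t - y, mem_twoCopies_unitReflect.1 hy, by ring⟩

namespace TernaryCantor

variable {l z : ℝ} {K : Set ℝ}

lemma two_mul_ne (hz : z ∉ IntermediateField.adjoin ℚ ({l} : Set ℝ)) : 2 * z ≠ 1 - l := by
  intro e
  apply hz
  rw [show z = (1 - l) / 2 by linarith]
  exact div_mem (sub_mem (OneMemClass.one_mem _) (IntermediateField.mem_adjoin_simple_self ℚ l))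
    (ofNat_mem _ 2)

/-- The offset `t` of a self-similar union of two copies has a finite expansion without the middle
digit. -/
lemma exists_offset_word (h : TernaryCantor l z K)
    (hz : z ∉ IntermediateField.adjoin ℚ ({l} : Set ℝ)) {t : ℝ} (ht : 0 < t) {n : ℕ}
    {f : Fin n → ℝ → ℝ} (hf : ∀ i, IsContractiveSimilitude (f i))
    (hU : twoCopies K t = ⋃ i, f i '' twoCopies K t) :
    ∃ w : List (Fin 3), l ^ w.length * t = ternaryValue l z w ∧ midWeight l w = 0 := by
  have hl := h.pos
  have hne := two_mul_ne hz
  have hne' : 2 * (1 - l - z) ≠ 1 - l := fun e => hne (by linarith)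
  obtain ⟨m₁, h₁⟩ := h.exists_pow_mul_mem hne ht hf hU
  obtain ⟨m₂, h₂⟩ := h.reflect.exists_pow_mul_mem hne' ht
    (fun i => isContractiveSimilitude_reflect (hf i) (1 + t)) (twoCopies_unitReflect_eq_iUnion hU)
  have s₁ : ScalesInto K K (l ^ (m₁ + m₂)) (l ^ (m₁ + m₂) * t) := fun x hx => by
    have := h.pow_left_mem (h₁ (x + t) (Or.inr (by simpa using hx))) m₂
    convert this using 1; ring
  have s₂ : ScalesInto (unitReflect K) (unitReflect K) (l ^ (m₁ + m₂)) (l ^ (m₁ + m₂) * t) :=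
    fun x hx => by
      have := h.reflect.pow_left_mem (h₂ (x + t) (Or.inr (by simpa using hx))) m₁
      convert this using 1; ring
  obtain ⟨w₁, hw₁, e₁⟩ := h.exists_word hne _ _ s₁
  obtain ⟨w₂, -, e₂⟩ := h.reflect.exists_word hne' _ _ s₂
  refine ⟨w₁, by rw [hw₁, e₁], ?_⟩
  have hlF := IntermediateField.mem_adjoin_simple_self ℚ l
  -- The reflected middle digit is `1 - l - z`, so `w₂` contributes its weight to the coefficient of
  -- `z` with the opposite sign.
  have hsum : midWeight l w₁ + midWeight l w₂ = 0 := by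
    refine coeff_eq_zero_of_notMem (β := (midWeight l w₂ + rightWeight l w₂ - rightWeight l w₁) *
      (1 - l)) hz (add_mem (midWeight_mem l _) (midWeight_mem l _))
      (mul_mem (sub_mem (add_mem (midWeight_mem l _) (rightWeight_mem l _)) (rightWeight_mem l _))
        (sub_mem (OneMemClass.one_mem _) hlF)) ?_
    rw [e₁, ternaryValue_eq, ternaryValue_eq] at e₂
    linear_combination e₂
  linarith [midWeight_nonneg hl w₁, midWeight_nonneg hl w₂]

/-- Some letter is `2`, and even in last position it contributes `(1 - l) * l ^ (w.length - 1)`.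
Applied to `l ^ M * t`, this yields `t ≥ (1 - l) / l > 2`. -/
lemma pow_length_le_of_midWeight_eq_zero (h : TernaryCantor l z K) (w : List (Fin 3))
    (hw : midWeight l w = 0) (hpos : 0 < ternaryValue l z w) :
    l ^ w.length * (1 - l) ≤ l * ternaryValue l z w := by
  have hl := h.pos
  have hl3 := h.lt_third
  induction w with
  | nil => simp [ternaryValue] at hpos
  | cons i w ih =>
    have hn := midWeight_nonneg hl w
    have hv := h.nonneg _ (h.value_mem w)
    have hp : l ^ w.length ≤ 1 := pow_le_one₀ hl.le (by linarith)
    rw [midWeight] at hw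
    rw [ternaryValue] at hpos ⊢
    rw [List.length_cons, pow_succ]
    fin_cases i
    · simp [ternaryDigit] at hw hpos ⊢
      have := ih (hw.resolve_left hl.ne') (pos_of_mul_pos_right hpos hl.le)
      nlinarith
    · simp at hw; nlinarith
    · have e : ternaryDigit l z ((fun i => i) ⟨2, by decide⟩) = 1 - l := rfl
      rw [e]
      have : l ^ w.length * l * (1 - l) ≤ 1 * (l * (1 - l)) := by
        rw [mul_assoc]; gcongr
        nlinarith
      have : 0 ≤ l * (l * ternaryValue l z w) := by positivity
      linarith

/-- A contraction of the union of two separated copies into itself that hits the left end of the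
cylinder `1 ^ N` preserves orientation, and its ratio is a power of `l` up to powers of `l`. -/
lemma ratio_of_hits_replicate (h : TernaryCantor l z K) (hne : 2 * z ≠ 1 - l) {t : ℝ} (ht : 2 < t)
    {r a : ℝ} (hr0 : r ≠ 0) (hr1 : |r| < 1) (hmaps : ∀ u ∈ twoCopies K t, r * u + a ∈ twoCopies K t)
    {N : ℕ} {y : ℝ} (hy : y ∈ twoCopies K t)
    (hyq : r * y + a = ternaryValue l z (List.replicate N 1)) :
    0 < r ∧ ∃ i j : ℕ, r * l ^ i = l ^ j := by
  have hl := h.pos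
  have hl1 : l < 1 := by linarith [h.lt_third]
  obtain ⟨τ, hyτ, hτ⟩ : ∃ τ, y - τ ∈ K ∧ ∀ x ∈ K, x + τ ∈ twoCopies K t := by
    rcases hy with hy | hy
    · exact ⟨0, by simpa using hy, fun x hx => Or.inl (by simpa using hx)⟩
    · exact ⟨t, hy, fun x hx => Or.inr (by simpa using hx)⟩
  set δ := min (z - l) (1 - 2 * l - z) with hδ
  have hδ0 : 0 < δ := lt_min (by linarith [h.lt_mid]) (by linarith [h.mid_lt])
  -- A level-`n` cylinder through `y` has image so small that it stays inside the isolated cylinder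
  -- `1 ^ N`.
  obtain ⟨n, hn⟩ := exists_pow_lt_of_lt_one (show 0 < l ^ N * δ by positivity) hl1
  obtain ⟨d, hd, x₀, hx₀, e₀⟩ := h.exists_cylinder n _ hyτ
  set q := ternaryValue l z (List.replicate N 1) with hq
  have hqK : q ∈ K := h.value_mem _
  have hx0 := h.nonneg _ hx₀
  have hx1 := h.le_one _ hx₀
  have hln : 0 < l ^ n := by positivity
  have hlN : 0 < l ^ N := by positivity
  have hlN1 : l ^ n ≤ 1 := pow_le_one₀ hl.le hl1.le
  have key : ∀ x ∈ K, r * l ^ n / l ^ N * (x - x₀) ∈ K := by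
    intro x hx
    have hmem := hmaps _ (hτ _ (hd x hx))
    have e : r * (l ^ n * x + d + τ) + a - q = r * (l ^ n * (x - x₀)) := by
      rw [← hyq, show y = l ^ n * x₀ + d + τ by linarith]; ring
    have hclose : |r * (l ^ n * x + d + τ) + a - q| < l ^ N * δ := by
      rw [e, abs_mul, abs_mul, abs_of_pos hln]
      have : |x - x₀| ≤ 1 := abs_le.2 ⟨by linarith [h.nonneg x hx], by linarith [h.le_one x hx]⟩
      refine lt_of_le_of_lt ?_ hn
      calc |r| * (l ^ n * |x - x₀|) ≤ 1 * (l ^ n * 1) := by gcongr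
        _ = l ^ n := by ring
    have hK : r * (l ^ n * x + d + τ) + a ∈ K := by
      rcases hmem with hm | hm
      · exact hm
      · exfalso
        have h1 := h.nonneg _ hm
        have h2 := h.le_one _ hqK
        have h3 : r * (l ^ n * (x - x₀)) ≤ 1 := by
          refine (le_abs_self _).trans ?_
          rw [← e]
          refine hclose.le.trans ?_
          have : l ^ N ≤ 1 := pow_le_one₀ hl.le hl1.le
          have : δ ≤ 1 := (min_le_left _ _).trans (by linarith [h.mid_lt])
          nlinarith
        linarith
    have := h.sub_div_mem_of_close (min_le_left _ _) (min_le_right _ _) N _ hK hclose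
    rw [← hq, e] at this
    convert this using 1; ring
  -- The point `x₀` goes to `0 = min K`, so it is the right or left end of `K` according to the sign
  -- of `r`.
  rcases lt_or_gt_of_ne hr0 with hneg | hpos
  · exfalso
    have hρ : r * l ^ n / l ^ N < 0 := div_neg_of_neg_of_pos (mul_neg_of_neg_of_pos hneg hln) hlN
    have hx : x₀ = 1 := by
      have := h.nonneg _ (key 1 h.one_mem)
      nlinarith
    refine h.not_scalesInto_reflect hne (r := -(r * l ^ n / l ^ N)) (by linarith) fun x hx' => ?_
    have := key _ hx'
    rw [hx] at this
    convert this using 1; ring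
  · have hρ : 0 < r * l ^ n / l ^ N := by positivity
    have hx : x₀ = 0 := by
      have := h.nonneg _ (key 0 h.zero_mem)
      nlinarith
    obtain ⟨k, hk⟩ := h.exists_eq_pow hρ (fun x hx' => by
      have := key _ hx'
      rw [hx] at this
      convert this using 1; ring)
    rw [div_eq_iff hlN.ne', ← pow_add] at hk
    exact ⟨hpos, n, k + N, hk⟩

theorem not_isSelfSimilarSet_twoCopies (h : TernaryCantor l z K)
    (hz : z ∉ IntermediateField.adjoin ℚ ({l} : Set ℝ)) {t : ℝ} (ht : 0 < t) :
    ¬ IsSelfSimilarSet (twoCopies K t) := by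
  rintro ⟨n, f, hf, -, -, hU⟩
  have hl := h.pos
  have hl3 := h.lt_third
  have hne := two_mul_ne hz
  have hlF := IntermediateField.mem_adjoin_simple_self ℚ l
  obtain ⟨w₀, hw₀, hmid₀⟩ := h.exists_offset_word hz ht hf hU
  have ht2 : 2 < t := by
    have hp : 0 < l ^ w₀.length := by positivity
    have := h.pow_length_le_of_midWeight_eq_zero w₀ hmid₀ (by rw [← hw₀]; positivity)
    rw [← hw₀, mul_left_comm] at this
    have := le_of_mul_le_mul_left this hp
    nlinarith
  choose r a hr0 hr1 hfra using hf
  -- This choice makes every cylinder of ratio `|r i|` shallower than `1 ^ N`, giving `k ≤ N` below.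
  obtain ⟨N, hN⟩ : ∃ N : ℕ, ∀ i, l ^ N < |r i| := by
    have : ∀ i, ∃ N : ℕ, l ^ N < |r i| := fun i => exists_pow_lt_of_lt_one (hr0 i) (by linarith)
    choose N hN using this
    refine ⟨Finset.univ.sup N, fun i => lt_of_le_of_lt ?_ (hN i)⟩
    exact pow_le_pow_of_le_one hl.le (by linarith) (Finset.le_sup (Finset.mem_univ i))
  have hq : ternaryValue l z (List.replicate N 1) ∈ twoCopies K t := Or.inl (h.value_mem _)
  rw [hU] at hq
  obtain ⟨i, y, hy, hyq⟩ := Set.mem_iUnion.1 hq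
  have hmaps : ∀ u ∈ twoCopies K t, r i * u + a i ∈ twoCopies K t := fun u hu => by
    rw [← hfra, hU]; exact Set.mem_iUnion.2 ⟨i, u, hu, rfl⟩
  rw [hfra] at hyq
  obtain ⟨hrpos, i₁, j₁, hij⟩ :=
    h.ratio_of_hits_replicate hne ht2 (abs_pos.1 (hr0 i)) (hr1 i) hmaps hy hyq
  have hlt := hr1 i
  have hNi := hN i
  rw [abs_of_pos hrpos] at hlt hNi
  set c := a i
  obtain ⟨k, hk1, hk⟩ : ∃ k : ℕ, 1 ≤ k ∧ r i = l ^ k := by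
    have hp : 0 < l ^ i₁ := by positivity
    have : i₁ < j₁ := by
      by_contra hle
      have := pow_le_pow_of_le_one hl.le (by linarith : l ≤ 1) (not_lt.1 hle)
      nlinarith
    refine ⟨j₁ - i₁, by omega, mul_right_cancel₀ hp.ne' ?_⟩
    rw [hij, ← pow_add]; congr 1; omega
  rw [hk] at hlt hNi hyq hmaps
  have hkN : k ≤ N := by
    by_contra hlt'
    have := pow_le_pow_of_le_one hl.le (by linarith : l ≤ 1) (not_le.1 hlt').le
    linarith
  have hp : 0 < l ^ k := by positivity
  have hkl : l ^ k ≤ 1 / 3 := by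
    have := pow_le_pow_of_le_one hl.le (by linarith : l ≤ 1) hk1
    linarith [pow_one l]
  have hloc : ∀ u ∈ twoCopies K t, u < t → u ∈ K := by
    rintro u (hu | hu) hlt
    · exact hu
    · linarith [h.nonneg _ hu]
  have hloc' : ∀ u ∈ twoCopies K t, u < t → u ≤ 1 := fun u hu hlt => h.le_one _ (hloc u hu hlt)
  have hy0 : 0 ≤ y := by rcases hy with hy | hy <;> linarith [h.nonneg _ hy]
  have hc1 : c ≤ 1 := by
    have := h.le_one _ (h.value_mem (List.replicate N 1))
    rw [← hyq] at this
    nlinarith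
  have s₁ : ScalesInto K K (l ^ k) c := fun x hx =>
    hloc _ (hmaps x (Or.inl hx)) (by nlinarith [h.le_one x hx])
  have hend := h.le_one _ (s₁.end_mem h.one_mem)
  have htl : l ^ k * t + c < t := by nlinarith
  have htc := hloc' _ (hmaps t (Or.inr (by simpa using h.zero_mem))) htl
  have s₂ : ScalesInto K K (l ^ k) (c + l ^ k * t) := fun x hx => by
    have := hloc _ (hmaps (x + t) (Or.inr (by simpa using hx))) (by nlinarith [h.le_one x hx])
    convert this using 1; ring
  obtain ⟨w₁, hw₁, e₁⟩ := h.exists_word hne k _ s₁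
  obtain ⟨w₂, hw₂, e₂⟩ := h.exists_word hne k _ s₂
  -- The two offsets differ by `l ^ k * t`, which has no `z`-part.
  have hmid : midWeight l w₂ = midWeight l w₁ := by
    have h0 : l ^ w₀.length * (midWeight l w₂ - midWeight l w₁) = 0 := by
      refine coeff_eq_zero_of_notMem (β := (l ^ k * rightWeight l w₀ -
        l ^ w₀.length * (rightWeight l w₂ - rightWeight l w₁)) * (1 - l)) hz
        (mul_mem (pow_mem hlF _) (sub_mem (midWeight_mem l _) (midWeight_mem l _)))
        (mul_mem (sub_mem (mul_mem (pow_mem hlF _) (rightWeight_mem l _))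
          (mul_mem (pow_mem hlF _) (sub_mem (rightWeight_mem l _) (rightWeight_mem l _))))
          (sub_mem (OneMemClass.one_mem _) hlF)) ?_
      rw [ternaryValue_eq] at e₁ e₂ hw₀
      rw [hmid₀] at hw₀
      linear_combination l ^ w₀.length * e₁ - l ^ w₀.length * e₂ + l ^ k * hw₀
    linarith [(mul_eq_zero.1 h0).resolve_left (by positivity)]
  -- Whichever of `K`, `K + t` contains `y` has image cylinder `1 ^ k`; equal weight forces the
  -- other to be the same.
  have hww : w₁ = w₂ := by
    rcases hy with hy | hy
    · have hw := h.prefix_eq_replicate hy w₁ N (by omega) (by rw [hw₁, ← e₁, hyq])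
      have := eq_replicate_of_midWeight_eq hl w₂ (by rw [hw₂, hmid, ← hw₁, ← hw])
      rw [this, hw, hw₁, hw₂]
    · have hw := h.prefix_eq_replicate hy w₂ N (by omega)
        (by rw [hw₂, ← e₂, ← hyq]; ring)
      have := eq_replicate_of_midWeight_eq hl w₁ (by rw [hw₁, ← hmid, ← hw₂, ← hw])
      rw [this, hw, hw₁, hw₂]
  rw [hww, ← e₂] at e₁
  have : 0 < l ^ k * t := by positivity
  linarith

end TernaryCantor

theorem theorem1p5 :
    (∀ (lam0 lam1 : ℝ), 0 < lam0 → 0 < lam1 → lam0 + lam1 < 1 →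
      Irrational (Real.log lam0 / Real.log lam1) →
      ∀ K : Set ℝ,
        IsAttractor ![fun x : ℝ => lam0 * x, fun x : ℝ => lam1 * x + 1 - lam1] K →
        ∀ (m : ℕ), 1 ≤ m → ∀ t : Fin (m + 1) → ℝ, Function.Injective t →
          ¬ IsSelfSimilarSet (⋃ j, setTranslate K (t j))) ∧
    (∀ (lam zeta : ℝ), 0 < lam → lam < 1 / 3 → lam < zeta → zeta < 1 - 2 * lam →
      zeta ∉ IntermediateField.adjoin ℚ ({lam} : Set ℝ) →
      ∀ K : Set ℝ,
        IsAttractor ![fun x : ℝ => lam * x, fun x : ℝ => lam * x + zeta,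
          fun x : ℝ => lam * x + 1 - lam] K →
        ∀ t : ℝ, 0 < t → ¬ IsSelfSimilarSet (K ∪ setTranslate K t)) := by
  constructor
  · intro a b ha hb hab hirr K hK m hm t ht
    exact not_isSelfSimilarSet_iUnion_translate (BinaryCantor.of_isAttractor ha hb hab hK) hirr hm ht
  · intro l z hl _ hlz hz hzF K hK t ht
    rw [union_setTranslate]
    exact (TernaryCantor.of_isAttractor hl hlz hz hK).not_isSelfSimilarSet_twoCopies hzF ht
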